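/- **Setting.** Let $f:\mathcal X\times\mathcal Y\to\mathcal Z$ be a function, where Al receives $x\in\mathcal X$ and Bob receives $y\in\mathcal Y$. Its *deterministic communication complexity* is the least depth of a deterministic two-party protocol tree computing $f$: at each inner node one player announces one bit depending on his own input, and the leaf reached on $(x,y)$ is labelled $f(x,y)$. In a *quantum protocol* each player has private qubits and there is a message register; all qubits are initially in the state $|0\rangle$. The players alternately act, Al first: at his turn a player applies a unitary transformation, depending on his input, to his private qubits and the message register, and then hands the message register over to the other player. After the last message its receiver acts once more; at the end each player measures his private qubits in the computational basis and computes an answer from the outcome and his input. The *communication* is the total number of qubits sent. The protocol computes $f$ with *error* $\varepsilon$ if, for all $x,y$, both players give the answer $f(x,y)$ with probability at least $1-\varepsilon$. A player taking Al's place may own any finite number of private qubits (initially in the state $|0\rangle$) and apply, at Al's turns, any unitary transformations depending on $x$ to them and the message register. He is *honest* if, for all inputs $x,y$ and every round in which Al has to send a message, the density matrix of the message that he sends in his interaction with the prescribed Bob equals the density matrix of the message that Al sends in the prescribed protocol. Since the players are *nonpreemptive*, only the final state counts: let $\rho_A^{xy}$ be the reduced density matrix of his private qubits at the end of the interaction (a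 message received in the last round can be moved into the private qubits by his last action). Honest players in Bob's place, and their final states $\rho_B^{xy}$, are defined symmetrically. Let $\|M\|_{t}=\mathrm{Tr}\sqrt{M^\dagger M}$ be the trace norm. **Theorem.** There is a universal constant $C$ such that for every function $f:\mathcal X\times\mathcal Y\to\mathcal Z$ with (finite) deterministic communication complexity $c$ and every $\varepsilon>0$ there is a quantum protocol with communication at most $C\,c^2$ that computes $f$ with error at most $\varepsilon$ and has the following properties. * For every honest player in Al's place there are density matrices $\sigma_A(x,z)$ ($x\in\mathcal X$, $z\in\mathcal Z$), depending only on his own input and a function value, such that $\|\rho_A^{xy}-\sigma_A(x,f(x,y))\|_{t}\le\varepsilon$ for all $x\in\mathcal X,\ y\in\mathcal Y$. * For every honest player in Bob's place there are density matrices $\sigma_B(y,z)$ ($y\in\mathcal Y$, $z\in\mathcal Z$) such that $\|\rho_B^{xy}-\sigma_B(y,f(x,y))\|_{t}\le\varepsilon$ for all $x\in\mathcal X,\ y\in\mathcal Y$. -/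

import Mathlib

universe u v w

/-! ### Deterministic communication complexity -/

/-- A deterministic two-party protocol tree. At an inner node one of the players announces one bit
computed from his own input (and from the node, that is, from the bits announced so far); a leaf
carries the answer, which is thereby known to both players. -/
inductive DetTree (X : Type u) (Y : Type v) (Z : Type w) : Type (max u v w)
  | leaf (z : Z) : DetTree X Y Z
  | al (bit : X → Bool) (child : Bool → DetTree X Y Z) : DetTree X Y Z
  | bob (bit : Y → Bool) (child : Bool → DetTree X Y Z) : DetTree X Y Z

namespace DetTree

variable {X : Type u} {Y : Type v} {Z : Type w}

/-- The answer reached on inputs `x`, `y`. -/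
def eval : DetTree X Y Z → X → Y → Z
  | leaf z, _, _ => z
  | al bit child, x, y => (child (bit x)).eval x y
  | bob bit child, x, y => (child (bit y)).eval x y

/-- The number of bits exchanged in the worst case. -/
def depth : DetTree X Y Z → ℕ
  | leaf _ => 0
  | al _ child => max (child false).depth (child true).depth + 1
  | bob _ child => max (child false).depth (child true).depth + 1

end DetTree

/-- The deterministic communication complexity of `f`: the least depth of a protocol tree that
computes `f` (and `⊤` if there is none). -/
noncomputable def detCC {X : Type u} {Y : Type v} {Z : Type w} (f : X → Y → Z) : ℕ∞ :=
  ⨅ (t : DetTree X Y Z) (_ : ∀ x y, t.eval x y = f x y), (t.depth : ℕ∞)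

/-! ### Quantum protocols -/

/-- The computational basis of a register of `n` qubits. -/
abbrev QubitBasis (n : ℕ) : Type := Fin n → Bool

/-- The way in which one of the two players, with inputs from `I`, acts in a protocol whose
messages consist of `k` qubits: he owns `mem` private qubits, and when it is his turn at time `t`
he applies the unitary transformation `op t i`, depending on his input `i`, to his private qubits
together with the `k` qubits of the message that he just received.
Measurements and other quantum operations are covered through additional private qubits. -/
structure QPlayer (I : Type u) (k : ℕ) : Type u where
  mem : ℕ
  op : ℕ → I → Matrix.unitaryGroup (QubitBasis mem × QubitBasis k) ℂ

/-- A joint pure state of Al's `a` private qubits, the `k` message qubits, and Bob's `b` private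
qubits, given by its amplitudes. -/
abbrev JointState (a k b : ℕ) : Type := QubitBasis a × QubitBasis k × QubitBasis b → ℂ

namespace JointState

variable {a k b : ℕ}

/-- All qubits are in the basis state `0`. -/
def blank (a k b : ℕ) : JointState a k b := fun s =>
  if s = (fun _ => false, fun _ => false, fun _ => false) then 1 else 0

/-- A transformation of Al's private qubits and the message qubits. -/
noncomputable def applyAl (U : Matrix (QubitBasis a × QubitBasis k) (QubitBasis a × QubitBasis k) ℂ)
    (ψ : JointState a k b) : JointState a k b := fun s =>
  ∑ r : QubitBasis a × QubitBasis k, U (s.1, s.2.1) r * ψ (r.1, r.2, s.2.2)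

/-- A transformation of Bob's private qubits and the message qubits. -/
noncomputable def applyBob
    (U : Matrix (QubitBasis b × QubitBasis k) (QubitBasis b × QubitBasis k) ℂ)
    (ψ : JointState a k b) : JointState a k b := fun s =>
  ∑ r : QubitBasis b × QubitBasis k, U (s.2.2, s.2.1) r * ψ (s.1, r.2, r.1)

/-- The reduced density matrix of the message qubits. -/
noncomputable def msgDensity (ψ : JointState a k b) :
    Matrix (QubitBasis k) (QubitBasis k) ℂ :=
  Matrix.of fun m m' => ∑ i : QubitBasis a, ∑ j : QubitBasis b, ψ (i, m, j) * star (ψ (i, m', j))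

/-- The reduced density matrix of Al's private qubits. -/
noncomputable def alDensity (ψ : JointState a k b) :
    Matrix (QubitBasis a) (QubitBasis a) ℂ :=
  Matrix.of fun i i' => ∑ m : QubitBasis k, ∑ j : QubitBasis b, ψ (i, m, j) * star (ψ (i', m, j))

/-- The reduced density matrix of Bob's private qubits. -/
noncomputable def bobDensity (ψ : JointState a k b) :
    Matrix (QubitBasis b) (QubitBasis b) ℂ :=
  Matrix.of fun j j' => ∑ i : QubitBasis a, ∑ m : QubitBasis k, ψ (i, m, j) * star (ψ (i, m, j'))

end JointState

/-- The joint state after the first `t` actions, when the players `A` and `B` interact on inputs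
`x`, `y`. Initially all qubits are blank; Al acts at the even times and Bob at the odd times, and
after each action the message qubits are handed over to the other player. -/
noncomputable def jointRun {X : Type u} {Y : Type v} {k : ℕ} (A : QPlayer X k) (B : QPlayer Y k)
    (x : X) (y : Y) : ℕ → JointState A.mem k B.mem
  | 0 => JointState.blank A.mem k B.mem
  | t + 1 =>
    if Even t then JointState.applyAl (A.op t x).1 (jointRun A B x y t)
    else JointState.applyBob (B.op t y).1 (jointRun A B x y t)

/-- A two-party quantum protocol with `rounds` messages of `width` qubits each. The message with
number `t < rounds` is sent after the action at time `t`. After the last message its receiver acts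
once more, at time `rounds`. Then each player measures his private qubits in the computational
basis and computes his answer from the outcome and his input. -/
structure QProtocol (X : Type u) (Y : Type v) (Z : Type w) : Type (max u v w) where
  width : ℕ
  rounds : ℕ
  al : QPlayer X width
  bob : QPlayer Y width
  alOut : X → QubitBasis al.mem → Z
  bobOut : Y → QubitBasis bob.mem → Z

namespace QProtocol

variable {X : Type u} {Y : Type v} {Z : Type w} (P : QProtocol X Y Z)

/-- The number of qubits exchanged. -/
def cost : ℕ := P.rounds * P.width

open Classical in
/-- The probability that both players give the answer `f x y` on inputs `x`, `y`. -/
noncomputable def successProb (f : X → Y → Z) (x : X) (y : Y) : ℝ :=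
  ∑ s : QubitBasis P.al.mem × QubitBasis P.width × QubitBasis P.bob.mem,
    if P.alOut x s.1 = f x y ∧ P.bobOut y s.2.2 = f x y then
      ‖jointRun P.al P.bob x y (P.rounds + 1) s‖ ^ 2
    else 0

/-- The protocol computes `f` with error at most `ε` on every input. -/
def ComputesWithError (f : X → Y → Z) (ε : ℝ) : Prop :=
  ∀ x y, 1 - ε ≤ P.successProb f x y

/-- A player `A`, who may behave differently from Al, is honest in Al's place: on all inputs, every
message that he sends in the course of the interaction with Bob has the density matrix prescribed
by the protocol. He may own any number of private qubits and may do anything else with them. -/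
def HonestAl (A : QPlayer X P.width) : Prop :=
  ∀ (x : X) (y : Y) (t : ℕ), t < P.rounds → Even t →
    (jointRun A P.bob x y (t + 1)).msgDensity = (jointRun P.al P.bob x y (t + 1)).msgDensity

/-- A player `B`, who may behave differently from Bob, is honest in Bob's place. -/
def HonestBob (B : QPlayer Y P.width) : Prop :=
  ∀ (x : X) (y : Y) (t : ℕ), t < P.rounds → Odd t →
    (jointRun P.al B x y (t + 1)).msgDensity = (jointRun P.al P.bob x y (t + 1)).msgDensity

/-- The final state of a player `A` who has played in Al's place. If the last message went to
him, then his last action can move it into his private qubits. -/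
noncomputable def finalAl (A : QPlayer X P.width) (x : X) (y : Y) :
    Matrix (QubitBasis A.mem) (QubitBasis A.mem) ℂ :=
  (jointRun A P.bob x y (P.rounds + 1)).alDensity

/-- The final state of a player `B` who has played in Bob's place. -/
noncomputable def finalBob (B : QPlayer Y P.width) (x : X) (y : Y) :
    Matrix (QubitBasis B.mem) (QubitBasis B.mem) ℂ :=
  (jointRun P.al B x y (P.rounds + 1)).bobDensity

end QProtocol

/-! ### States and their distance -/

open scoped ComplexOrder in
/-- Density matrices: positive semidefinite of trace one. -/
def IsDensityMatrix {n : Type*} [Fintype n] (ρ : Matrix n n ℂ) : Prop :=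
  ρ.PosSemidef ∧ ρ.trace = 1

/-- The trace norm: the sum of the singular values, i.e. of the square roots of the eigenvalues
of `Aᴴ * A`. -/
noncomputable def traceNorm {n : Type*} [Fintype n] [DecidableEq n] (A : Matrix n n ℂ) : ℝ :=
  ∑ i, Real.sqrt ((Matrix.isHermitian_conjTranspose_mul_self A).eigenvalues i)

/-! The message register carries the whole computation. A deterministic protocol of depth `c` is run
reversibly on the register: the transcript is computed bit by bit, a canonical name of the answer is
written next to it, and the transcript is uncomputed. At the end the register depends on the
function value only, and both players copy it.

The first action also puts a small nonzero amplitude on a dummy basis state that every later move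
fixes. Hence the messages on any two input pairs are never orthogonal at any time, while the error
stays below `ε`.

This overlap prevents an honest player from learning more. Before the copying stage the prescribed
messages are pure, so the player's private qubits are unentangled with them. For two inputs of the
other player, unitarity preserves the overlap of the joint states and the prescribed unitary
preserves that of the messages. Dividing by the nonzero message overlap, the private states have
inner product 1 and thus coincide (`exists_common_tensorVec`). By induction the private state does
not depend on the other input (`exists_jointRun_al`, `exists_jointRun_bob`). If the function values
agree, so do the final messages, and the final states are exactly equal; `ε` is needed only for the
error probability. -/

/-! ### Linear algebra of bipartite states -/

section Bipartite

open Matrix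

open scoped Kronecker ComplexOrder

variable {α κ : Type*} [Fintype α] [Fintype κ]

/-- The product of two vectors. -/
def tensorVec (φ : α → ℂ) (ψ : κ → ℂ) : α × κ → ℂ := fun r => φ r.1 * ψ r.2

/-- The reduced density matrix of the second component of a bipartite vector. -/
noncomputable def reducedDensity (χ : α × κ → ℂ) : Matrix κ κ ℂ :=
  Matrix.of fun m m' => ∑ i, χ (i, m) * star (χ (i, m'))

theorem reducedDensity_tensorVec {α κ : Type*} [Fintype α] (φ : α → ℂ) (ψ : κ → ℂ) :
    reducedDensity (tensorVec φ ψ) = (star φ ⬝ᵥ φ) • vecMulVec ψ (star ψ) := by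
  ext m m'
  simp only [reducedDensity, tensorVec, of_apply, dotProduct, Matrix.smul_apply, vecMulVec_apply,
    Pi.star_apply, star_mul', smul_eq_mul, Finset.sum_mul]
  exact Finset.sum_congr rfl fun _ _ => by ring

theorem star_tensorVec_dotProduct (φ φ' : α → ℂ) (ψ ψ' : κ → ℂ) :
    star (tensorVec φ ψ) ⬝ᵥ tensorVec φ' ψ' = (star φ ⬝ᵥ φ') * (star ψ ⬝ᵥ ψ') := by
  simp only [dotProduct, tensorVec, Pi.star_apply, star_mul', Fintype.sum_prod_type,
    Finset.sum_mul_sum]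
  exact Finset.sum_congr rfl fun _ _ => Finset.sum_congr rfl fun _ _ => by ring

/-- A bipartite vector whose second component is in a pure state is a product vector. -/
theorem eq_tensorVec_of_reducedDensity {χ : α × κ → ℂ} {ψ : κ → ℂ}
    (hψ : star ψ ⬝ᵥ ψ = 1) (h : reducedDensity χ = vecMulVec ψ (star ψ)) :
    χ = tensorVec (fun i => ∑ m, star (ψ m) * χ (i, m)) ψ := by
  classical
  set M : Matrix κ α ℂ := Matrix.of fun m i => χ (i, m) with hM
  set Q : Matrix κ κ ℂ := vecMulVec ψ (star ψ) with hQ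
  have hMM : M * Mᴴ = Q := by
    rw [← h]; ext m m'; simp [hM, mul_apply, reducedDensity]
  have hQQ : Q * Q = Q := by
    rw [hQ, vecMulVec_mul_vecMulVec, hψ]; simp
  -- `Q = M * Mᴴ` is a projection, so `(1 - Q) * M` times its adjoint is `(1 - Q) * Q * (1 - Q) =
  -- 0`.
  have hz : (1 - Q) * M = 0 := by
    rw [← self_mul_conjTranspose_eq_zero, conjTranspose_mul, Matrix.mul_assoc,
      ← Matrix.mul_assoc M, hMM, ← Matrix.mul_assoc, Matrix.sub_mul, hQQ]
    simp
  have hz' : M = Q * M := by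
    rw [Matrix.sub_mul, Matrix.one_mul, sub_eq_zero] at hz; exact hz
  ext ⟨i, m⟩
  have := congrFun (congrFun hz' m) i
  simp only [hM, hQ, mul_apply, of_apply, vecMulVec_apply, Pi.star_apply] at this
  rw [this, tensorVec, Finset.sum_mul]
  exact Finset.sum_congr rfl fun _ _ => by ring

theorem one_kronecker_mulVec_tensorVec [DecidableEq α] (U : Matrix κ κ ℂ) (φ : α → ℂ) (ψ : κ → ℂ) :
    ((1 : Matrix α α ℂ) ⊗ₖ U) *ᵥ tensorVec φ ψ = tensorVec φ (U *ᵥ ψ) := by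
  ext ⟨i, m⟩
  simp only [mulVec, dotProduct, kroneckerMap_apply, tensorVec, Fintype.sum_prod_type, one_apply,
    ite_mul, one_mul, zero_mul, Finset.mul_sum]
  rw [Finset.sum_eq_single i (by intro j _ hj; simp [hj.symm]) (by simp)]
  exact Finset.sum_congr rfl fun _ _ => by simp; ring

variable [DecidableEq α] [DecidableEq κ]

theorem star_unitary_mulVec_dotProduct (U : unitaryGroup α ℂ) (v w : α → ℂ) :
    star (U.1 *ᵥ v) ⬝ᵥ (U.1 *ᵥ w) = star v ⬝ᵥ w := by
  rw [star_mulVec, ← dotProduct_mulVec, mulVec_mulVec, ← star_eq_conjTranspose,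
    mem_unitaryGroup_iff'.1 U.2, one_mulVec]

/-- If a unitary transformation of `α × κ` takes two vectors `φ ⊗ ψ₁` and `φ ⊗ ψ₂` with
non-orthogonal `ψ₁` and `ψ₂` to vectors whose second components are in the pure states `V ψ₁` and
`V ψ₂` for a unitary `V`, then the first component is left in the same state in both cases. -/
theorem exists_common_tensorVec (W : unitaryGroup (α × κ) ℂ) (V : unitaryGroup κ ℂ)
    {φ : α → ℂ} {ψ₁ ψ₂ : κ → ℂ} (hφ : star φ ⬝ᵥ φ = 1)
    (h₁ : star ψ₁ ⬝ᵥ ψ₁ = 1) (h₂ : star ψ₂ ⬝ᵥ ψ₂ = 1) (h₁₂ : star ψ₁ ⬝ᵥ ψ₂ ≠ 0)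
    (hd₁ : reducedDensity (W.1 *ᵥ tensorVec φ ψ₁) = vecMulVec (V.1 *ᵥ ψ₁) (star (V.1 *ᵥ ψ₁)))
    (hd₂ : reducedDensity (W.1 *ᵥ tensorVec φ ψ₂) = vecMulVec (V.1 *ᵥ ψ₂) (star (V.1 *ᵥ ψ₂))) :
    ∃ φ' : α → ℂ, star φ' ⬝ᵥ φ' = 1 ∧ W.1 *ᵥ tensorVec φ ψ₁ = tensorVec φ' (V.1 *ᵥ ψ₁) ∧
      W.1 *ᵥ tensorVec φ ψ₂ = tensorVec φ' (V.1 *ᵥ ψ₂) := by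
  have e₁ := eq_tensorVec_of_reducedDensity (by rw [star_unitary_mulVec_dotProduct, h₁]) hd₁
  have e₂ := eq_tensorVec_of_reducedDensity (by rw [star_unitary_mulVec_dotProduct, h₂]) hd₂
  generalize (fun i => ∑ m, star ((V.1 *ᵥ ψ₁) m) * (W.1 *ᵥ tensorVec φ ψ₁) (i, m)) = φ₁ at e₁
  generalize (fun i => ∑ m, star ((V.1 *ᵥ ψ₂) m) * (W.1 *ᵥ tensorVec φ ψ₂) (i, m)) = φ₂ at e₂
  -- `W` preserves the overlap of the product vectors and `V` that of the second factors; the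
  -- nonzero common factor cancels.
  have key : ∀ {η η' : α → ℂ} {ξ ξ' : κ → ℂ}, star ξ ⬝ᵥ ξ' ≠ 0 →
      W.1 *ᵥ tensorVec φ ξ = tensorVec η (V.1 *ᵥ ξ) →
      W.1 *ᵥ tensorVec φ ξ' = tensorVec η' (V.1 *ᵥ ξ') → star η ⬝ᵥ η' = 1 := by
    intro η η' ξ ξ' hne h h'
    have := star_unitary_mulVec_dotProduct W (tensorVec φ ξ) (tensorVec φ ξ')
    rw [h, h', star_tensorVec_dotProduct, star_tensorVec_dotProduct,
      star_unitary_mulVec_dotProduct, hφ] at this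
    exact mul_right_cancel₀ hne this
  have h₂₁ : star ψ₂ ⬝ᵥ ψ₁ ≠ 0 := by
    intro h
    apply h₁₂
    have := congrArg star h
    rwa [star_zero, ← star_dotProduct_star, star_star] at this
  -- All four inner products among `φ₁`, `φ₂` equal 1, so the squared norm of the difference is `1 -
  -- 1 - 1 + 1`.
  have hsub : φ₁ - φ₂ = 0 := by
    rw [← dotProduct_star_self_eq_zero, star_sub, sub_dotProduct, dotProduct_sub, dotProduct_sub,
      key (by simp [h₁]) e₁ e₁, key (by simp [h₂]) e₂ e₂, key h₁₂ e₁ e₂, key h₂₁ e₂ e₁]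
    simp
  rw [sub_eq_zero] at hsub
  exact ⟨φ₁, key (by simp [h₁]) e₁ e₁, e₁, hsub ▸ e₂⟩

/-- The unitary transformation that permutes the basis vectors by `π`. -/
noncomputable def permUnitary (π : Equiv.Perm α) : unitaryGroup α ℂ :=
  ⟨(π⁻¹).permMatrix ℂ, by
    rw [mem_unitaryGroup_iff, star_eq_conjTranspose, conjTranspose_permMatrix, ← permMatrix_mul]
    simp⟩

theorem permUnitary_mulVec (π : Equiv.Perm α) (v : α → ℂ) :
    (permUnitary π).1 *ᵥ v = v ∘ (π⁻¹ : Equiv.Perm α) :=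
  permMatrix_mulVec _

theorem permUnitary_mulVec_single (π : Equiv.Perm α) (i : α) (z : ℂ) :
    (permUnitary π).1 *ᵥ Pi.single i z = Pi.single (π i) z := by
  rw [permUnitary_mulVec]
  ext j
  simp only [Function.comp, Pi.single_apply, Equiv.Perm.inv_eq_iff_eq, @eq_comm _ j]

/-- The action of a unitary transformation on the second component. -/
noncomputable def oneTensor (α : Type*) [Fintype α] [DecidableEq α] (U : unitaryGroup κ ℂ) :
    unitaryGroup (α × κ) ℂ :=
  ⟨(1 : Matrix α α ℂ) ⊗ₖ U.1, kronecker_mem_unitary (one_mem _) U.2⟩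

/-- For distinct `i`, `j` and every small `r` there is a unitary transformation that takes the
basis vector `i` to a superposition of the basis vectors `i` and `j`. -/
theorem exists_unitary_superposition {i j : α} (hij : i ≠ j) {r : ℝ} (h0 : 0 < r) (h1 : r < 1) :
    ∃ (U : unitaryGroup α ℂ) (q : ℝ), q ≠ 0 ∧
      U.1 *ᵥ Pi.single i 1 = Pi.single i ((1 - 2 * r : ℝ) : ℂ) + Pi.single j (q : ℂ) := by
  set a : ℝ := √r
  set b : ℝ := √(1 - r)
  have ha : a * a = r := Real.mul_self_sqrt h0.le
  have hb : b * b = 1 - r := Real.mul_self_sqrt (by linarith)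
  set v : α → ℂ := Pi.single i (a : ℂ) + Pi.single j (b : ℂ) with hv
  have hsv : star v = v := by
    rw [hv, star_add, ← Pi.single_star, ← Pi.single_star]; simp
  have hvv : star v ⬝ᵥ v = 1 := by
    rw [hsv, hv]
    simp only [add_dotProduct, single_dotProduct, Pi.add_apply, Pi.single_eq_same,
      Pi.single_eq_of_ne hij, Pi.single_eq_of_ne hij.symm]
    norm_cast
    linarith
  -- The reflection in the hyperplane orthogonal to `v` sends the basis vector `i` to itself minus
  -- `2 a v`, with coefficients `1 - 2 a²` at `i` and `-2 a b` at `j`.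
  refine ⟨⟨1 - (2 : ℂ) • vecMulVec v (star v), ?_⟩, -(2 * a * b), ?_, ?_⟩
  · have hh : (vecMulVec v (star v))ᴴ = vecMulVec v (star v) := by
      rw [conjTranspose_vecMulVec, star_star]
    have h2 : vecMulVec v (star v) * vecMulVec v (star v) = vecMulVec v (star v) := by
      rw [vecMulVec_mul_vecMulVec, hvv]; simp
    rw [mem_unitaryGroup_iff, star_eq_conjTranspose, conjTranspose_sub, conjTranspose_smul, hh,
      conjTranspose_one, Matrix.sub_mul, Matrix.mul_sub, Matrix.mul_sub, Matrix.smul_mul,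
      Matrix.smul_mul, Matrix.mul_smul, Matrix.mul_smul, h2]
    have : star (2 : ℂ) = 2 := by simp
    rw [this]
    simp only [Matrix.one_mul, Matrix.mul_one, smul_smul]
    module
  · have : 0 < a := Real.sqrt_pos.2 h0
    have : 0 < b := Real.sqrt_pos.2 (by linarith)
    exact neg_ne_zero.2 (by positivity)
  · rw [sub_mulVec, one_mulVec, smul_mulVec, vecMulVec_mulVec, hsv]
    ext l
    have hai : (v ⬝ᵥ Pi.single i 1) = a := by
      simp [hv, Pi.single_eq_of_ne hij]
    rw [hai]
    have hac : (a : ℂ) * a = r := by exact_mod_cast ha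
    simp only [hv, Pi.add_apply, Pi.sub_apply, Pi.smul_apply, Pi.single_apply, smul_eq_mul,
      MulOpposite.smul_eq_mul_unop, MulOpposite.unop_op]
    by_cases hli : l = i
    · subst hli
      simp only [if_true, if_neg hij]
      push_cast
      linear_combination (-2 : ℂ) * hac
    · by_cases hlj : l = j
      · subst hlj
        simp only [if_true, if_neg hli]
        push_cast
        ring
      · simp [hli, hlj]

end Bipartite

/-! ### Joint states -/

section Joint

open Matrix

open scoped ComplexOrder

variable {a k b : ℕ}

namespace JointState

/-- A joint state in which Bob's private qubits are not entangled with the rest. -/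
def joinAl (χ : QubitBasis a × QubitBasis k → ℂ) (β : QubitBasis b → ℂ) : JointState a k b :=
  fun s => χ (s.1, s.2.1) * β s.2.2

/-- A joint state in which Al's private qubits are not entangled with the rest. -/
def joinBob (α : QubitBasis a → ℂ) (χ : QubitBasis b × QubitBasis k → ℂ) : JointState a k b :=
  fun s => α s.1 * χ (s.2.2, s.2.1)

/-- A full product state can be regrouped around either player, which lets Al's and Bob's actions
alternate in one induction. -/
theorem joinAl_tensorVec (φ : QubitBasis a → ℂ) (ψ : QubitBasis k → ℂ) (β : QubitBasis b → ℂ) :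
    joinAl (tensorVec φ ψ) β = joinBob φ (tensorVec β ψ) := by
  ext s; simp only [joinAl, joinBob, tensorVec]; ring

theorem applyAl_joinAl (U : Matrix (QubitBasis a × QubitBasis k) (QubitBasis a × QubitBasis k) ℂ)
    (χ : QubitBasis a × QubitBasis k → ℂ) (β : QubitBasis b → ℂ) :
    applyAl U (joinAl χ β) = joinAl (U *ᵥ χ) β := by
  ext s
  simp only [applyAl, joinAl, mulVec, dotProduct, Finset.sum_mul]
  exact Finset.sum_congr rfl fun _ _ => by ring

theorem applyBob_joinBob (U : Matrix (QubitBasis b × QubitBasis k) (QubitBasis b × QubitBasis k) ℂ)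
    (α : QubitBasis a → ℂ) (χ : QubitBasis b × QubitBasis k → ℂ) :
    applyBob U (joinBob α χ) = joinBob α (U *ᵥ χ) := by
  ext s
  simp only [applyBob, joinBob, mulVec, dotProduct, Finset.mul_sum]
  exact Finset.sum_congr rfl fun _ _ => by ring

theorem applyAl_eq_mulVec
    (U : Matrix (QubitBasis a × QubitBasis k) (QubitBasis a × QubitBasis k) ℂ)
    (ψ : JointState a k b) (s : QubitBasis a × QubitBasis k × QubitBasis b) :
    applyAl U ψ s = (U *ᵥ fun r => ψ (r.1, r.2, s.2.2)) (s.1, s.2.1) := rfl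

theorem applyBob_eq_mulVec
    (U : Matrix (QubitBasis b × QubitBasis k) (QubitBasis b × QubitBasis k) ℂ)
    (ψ : JointState a k b) (s : QubitBasis a × QubitBasis k × QubitBasis b) :
    applyBob U ψ s = (U *ᵥ fun r => ψ (s.1, r.2, r.1)) (s.2.2, s.2.1) := rfl

theorem msgDensity_joinAl (χ : QubitBasis a × QubitBasis k → ℂ) {β : QubitBasis b → ℂ}
    (hβ : star β ⬝ᵥ β = 1) : (joinAl χ β).msgDensity = reducedDensity χ := by
  ext m m'
  simp only [msgDensity, joinAl, reducedDensity, of_apply, star_mul']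
  refine Finset.sum_congr rfl fun i _ => ?_
  calc ∑ j, χ (i, m) * β j * (star (χ (i, m')) * star (β j))
      = χ (i, m) * star (χ (i, m')) * (star β ⬝ᵥ β) := by
        rw [dotProduct, Finset.mul_sum]
        exact Finset.sum_congr rfl fun _ _ => by simp only [Pi.star_apply]; ring
    _ = _ := by rw [hβ, mul_one]

theorem msgDensity_joinBob {α : QubitBasis a → ℂ} (χ : QubitBasis b × QubitBasis k → ℂ)
    (hα : star α ⬝ᵥ α = 1) : (joinBob α χ).msgDensity = reducedDensity χ := by
  ext m m'
  simp only [msgDensity, joinBob, reducedDensity, of_apply, star_mul']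
  rw [Finset.sum_comm]
  refine Finset.sum_congr rfl fun i _ => ?_
  calc ∑ j, α j * χ (i, m) * (star (α j) * star (χ (i, m')))
      = χ (i, m) * star (χ (i, m')) * (star α ⬝ᵥ α) := by
        rw [dotProduct, Finset.mul_sum]
        exact Finset.sum_congr rfl fun _ _ => by simp only [Pi.star_apply]; ring
    _ = _ := by rw [hα, mul_one]

/-- The blank state of a register. -/
noncomputable def blankVec (n : ℕ) : QubitBasis n → ℂ := Pi.single (fun _ => false) 1

theorem star_blankVec_dotProduct (n : ℕ) : star (blankVec n) ⬝ᵥ blankVec n = 1 := by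
  rw [blankVec, ← Pi.single_star]; simp

theorem blank_eq_joinAl : blank a k b = joinAl (tensorVec (blankVec a) (blankVec k)) (blankVec b) := by
  ext ⟨i, m, j⟩
  simp only [blank, joinAl, tensorVec, blankVec, Pi.single_apply, Prod.mk.injEq, ite_and]
  split_ifs <;> simp

theorem star_blank_dotProduct : star (blank a k b) ⬝ᵥ blank a k b = 1 := by
  have : blank a k b = Pi.single (fun _ => false, fun _ => false, fun _ => false) 1 := by
    ext s; simp only [blank, Pi.single_apply]
  rw [this, ← Pi.single_star]; simp

/-- The joint vector splits into slices indexed by Bob's basis states, and `U` acts isometrically on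
each slice. -/
theorem star_applyAl_dotProduct (U : unitaryGroup (QubitBasis a × QubitBasis k) ℂ)
    (ψ : JointState a k b) : star (applyAl U.1 ψ) ⬝ᵥ applyAl U.1 ψ = star ψ ⬝ᵥ ψ := by
  have key : ∀ χ : JointState a k b, star χ ⬝ᵥ χ =
      ∑ j, star (fun r : QubitBasis a × QubitBasis k => χ (r.1, r.2, j)) ⬝ᵥ
        fun r => χ (r.1, r.2, j) := by
    intro χ
    simp only [dotProduct, Fintype.sum_prod_type, Pi.star_apply]
    rw [Finset.sum_comm (s := (Finset.univ : Finset (QubitBasis b)))]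
    exact Finset.sum_congr rfl fun i _ => Finset.sum_comm
  rw [key, key ψ]
  refine Finset.sum_congr rfl fun j _ => ?_
  have : (fun r : QubitBasis a × QubitBasis k => applyAl U.1 ψ (r.1, r.2, j)) =
      U.1 *ᵥ fun r => ψ (r.1, r.2, j) := funext fun r => applyAl_eq_mulVec _ _ _
  rw [this, star_unitary_mulVec_dotProduct]

theorem star_applyBob_dotProduct (U : unitaryGroup (QubitBasis b × QubitBasis k) ℂ)
    (ψ : JointState a k b) : star (applyBob U.1 ψ) ⬝ᵥ applyBob U.1 ψ = star ψ ⬝ᵥ ψ := by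
  have key : ∀ χ : JointState a k b, star χ ⬝ᵥ χ =
      ∑ i, star (fun r : QubitBasis b × QubitBasis k => χ (i, r.2, r.1)) ⬝ᵥ
        fun r => χ (i, r.2, r.1) := by
    intro χ
    simp only [dotProduct, Fintype.sum_prod_type, Pi.star_apply]
    exact Finset.sum_congr rfl fun i _ => Finset.sum_comm
  rw [key, key ψ]
  refine Finset.sum_congr rfl fun i _ => ?_
  have : (fun r : QubitBasis b × QubitBasis k => applyBob U.1 ψ (i, r.2, r.1)) =
      U.1 *ᵥ fun r => ψ (i, r.2, r.1) := funext fun r => applyBob_eq_mulVec _ _ _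
  rw [this, star_unitary_mulVec_dotProduct]

theorem isDensityMatrix_alDensity {ψ : JointState a k b} (h : star ψ ⬝ᵥ ψ = 1) :
    IsDensityMatrix ψ.alDensity := by
  constructor
  · have : ψ.alDensity = ∑ m, ∑ j, vecMulVec (fun i => ψ (i, m, j)) (star fun i => ψ (i, m, j)) := by
      ext i i'
      simp [alDensity, Matrix.sum_apply, vecMulVec_apply]
    rw [this]
    exact posSemidef_sum _ fun m _ => posSemidef_sum _ fun j _ => posSemidef_vecMulVec_self_star _
  · rw [← h]
    simp only [trace, alDensity, diag_apply, of_apply, dotProduct, Fintype.sum_prod_type,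
      Pi.star_apply, mul_comm]

theorem isDensityMatrix_bobDensity {ψ : JointState a k b} (h : star ψ ⬝ᵥ ψ = 1) :
    IsDensityMatrix ψ.bobDensity := by
  constructor
  · have : ψ.bobDensity = ∑ i, ∑ m, vecMulVec (fun j => ψ (i, m, j)) (star fun j => ψ (i, m, j)) := by
      ext i i'
      simp [bobDensity, Matrix.sum_apply, vecMulVec_apply]
    rw [this]
    exact posSemidef_sum _ fun m _ => posSemidef_sum _ fun j _ => posSemidef_vecMulVec_self_star _
  · rw [← h]
    simp only [trace, bobDensity, diag_apply, of_apply, dotProduct, Fintype.sum_prod_type,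
      Pi.star_apply, mul_comm]
    rw [Finset.sum_comm]
    exact Finset.sum_congr rfl fun _ _ => Finset.sum_comm

end JointState

theorem star_jointRun_dotProduct {X : Type u} {Y : Type v} (A : QPlayer X k) (B : QPlayer Y k)
    (x : X) (y : Y) (t : ℕ) : star (jointRun A B x y t) ⬝ᵥ jointRun A B x y t = 1 := by
  induction t with
  | zero => exact JointState.star_blank_dotProduct
  | succ t ih =>
    rw [jointRun]
    split_ifs
    · rw [JointState.star_applyAl_dotProduct, ih]
    · rw [JointState.star_applyBob_dotProduct, ih]

theorem traceNorm_zero {n : Type*} [Fintype n] [DecidableEq n] :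
    traceNorm (0 : Matrix n n ℂ) = 0 := by
  have : (isHermitian_conjTranspose_mul_self (0 : Matrix n n ℂ)).eigenvalues = 0 := by
    rw [IsHermitian.eigenvalues_eq_zero_iff]; simp
  exact Finset.sum_eq_zero fun i _ => by rw [congrFun this i]; simp

/-- Some density matrix on `n` qubits. -/
theorem exists_isDensityMatrix (n : ℕ) :
    ∃ ρ : Matrix (QubitBasis n) (QubitBasis n) ℂ, IsDensityMatrix ρ :=
  ⟨_, JointState.isDensityMatrix_alDensity (JointState.star_blank_dotProduct (a := n) (k := 0)
    (b := 0))⟩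

namespace QProtocol

variable {X : Type u} {Y : Type v} {Z : Type w} (P : QProtocol X Y Z)

/-- The target state is the final state for any `y` that realizes the value; for values that are not
attained any density matrix will do. The trace distance is then exactly 0. -/
theorem exists_alDensity_of_finalAl_eq {f : X → Y → Z} (A : QPlayer X P.width)
    (h : ∀ x y y', f x y = f x y' → P.finalAl A x y = P.finalAl A x y') {ε : ℝ} (hε : 0 ≤ ε) :
    ∃ σ : X → Z → Matrix (QubitBasis A.mem) (QubitBasis A.mem) ℂ,
      (∀ x z, IsDensityMatrix (σ x z)) ∧
      ∀ x y, traceNorm (P.finalAl A x y - σ x (f x y)) ≤ ε := by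
  have key : ∀ x z, ∃ ρ : Matrix (QubitBasis A.mem) (QubitBasis A.mem) ℂ,
      IsDensityMatrix ρ ∧ ∀ y, f x y = z → P.finalAl A x y = ρ := by
    intro x z
    by_cases hz : ∃ y, f x y = z
    · obtain ⟨y, rfl⟩ := hz
      exact ⟨P.finalAl A x y, JointState.isDensityMatrix_alDensity (star_jointRun_dotProduct ..),
        fun y' hy' => h x y' y hy'⟩
    · obtain ⟨ρ, hρ⟩ := exists_isDensityMatrix A.mem
      exact ⟨ρ, hρ, fun y hy => absurd ⟨y, hy⟩ hz⟩
  choose σ h₁ h₂ using key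
  refine ⟨σ, h₁, fun x y => ?_⟩
  rw [h₂ x _ y rfl, sub_self, traceNorm_zero]
  exact hε

theorem exists_bobDensity_of_finalBob_eq {f : X → Y → Z} (B : QPlayer Y P.width)
    (h : ∀ x x' y, f x y = f x' y → P.finalBob B x y = P.finalBob B x' y) {ε : ℝ} (hε : 0 ≤ ε) :
    ∃ σ : Y → Z → Matrix (QubitBasis B.mem) (QubitBasis B.mem) ℂ,
      (∀ y z, IsDensityMatrix (σ y z)) ∧
      ∀ x y, traceNorm (P.finalBob B x y - σ y (f x y)) ≤ ε := by
  have key : ∀ y z, ∃ ρ : Matrix (QubitBasis B.mem) (QubitBasis B.mem) ℂ,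
      IsDensityMatrix ρ ∧ ∀ x, f x y = z → P.finalBob B x y = ρ := by
    intro y z
    by_cases hz : ∃ x, f x y = z
    · obtain ⟨x, rfl⟩ := hz
      exact ⟨P.finalBob B x y, JointState.isDensityMatrix_bobDensity (star_jointRun_dotProduct ..),
        fun x' hx' => h x' x y hx'⟩
    · obtain ⟨ρ, hρ⟩ := exists_isDensityMatrix B.mem
      exact ⟨ρ, hρ, fun x hx => absurd ⟨x, hx⟩ hz⟩
  choose σ h₁ h₂ using key
  refine ⟨σ, h₁, fun x y => ?_⟩
  rw [h₂ y _ x rfl, sub_self, traceNorm_zero]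
  exact hε

end QProtocol

end Joint

/-! ### Protocols in which the message register carries the whole computation -/

section MessageProtocol

open Matrix

variable {X : Type u} {Y : Type v} {Z : Type w} {k : ℕ}

/-- The state of the message register after `t` actions on it alone. -/
noncomputable def msgRun (U : ℕ → X → unitaryGroup (QubitBasis k) ℂ)
    (V : ℕ → Y → unitaryGroup (QubitBasis k) ℂ) (x : X) (y : Y) : ℕ → QubitBasis k → ℂ
  | 0 => JointState.blankVec k
  | t + 1 =>
    if Even t then (U t x).1 *ᵥ msgRun U V x y t else (V t y).1 *ᵥ msgRun U V x y t

theorem star_msgRun_dotProduct (U : ℕ → X → unitaryGroup (QubitBasis k) ℂ)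
    (V : ℕ → Y → unitaryGroup (QubitBasis k) ℂ) (x : X) (y : Y) (t : ℕ) :
    star (msgRun U V x y t) ⬝ᵥ msgRun U V x y t = 1 := by
  induction t with
  | zero => exact JointState.star_blankVec_dotProduct k
  | succ t ih =>
    rw [msgRun]
    split_ifs <;> rw [star_unitary_mulVec_dotProduct, ih]

/-- Addition of the second register to the first one. -/
def copyPerm (n : ℕ) : Equiv.Perm (QubitBasis n × QubitBasis n) :=
  Function.Involutive.toPerm (fun r => (fun i => xor (r.1 i) (r.2 i), r.2))
    (fun r => by ext <;> simp)

theorem copyPerm_inv (n : ℕ) : (copyPerm n)⁻¹ = copyPerm n :=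
  Function.Involutive.toPerm_symm _

theorem copyPerm_self {n : ℕ} (s : QubitBasis n) : copyPerm n (s, s) = (fun _ => false, s) := by
  change ((fun i => xor (s i) (s i), s) : QubitBasis n × QubitBasis n) = _
  simp

theorem jointRun_succ_of_even (A : QPlayer X k) (B : QPlayer Y k) (x : X) (y : Y) {t : ℕ}
    (ht : Even t) : jointRun A B x y (t + 1) =
      JointState.applyAl (A.op t x).1 (jointRun A B x y t) := by
  rw [jointRun, if_pos ht]

theorem jointRun_succ_of_not_even (A : QPlayer X k) (B : QPlayer Y k) (x : X) (y : Y) {t : ℕ}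
    (ht : ¬Even t) : jointRun A B x y (t + 1) =
      JointState.applyBob (B.op t y).1 (jointRun A B x y t) := by
  rw [jointRun, if_neg ht]

/-- The player who acts on the message register alone before time `T`, and from then on copies the
message register into his private qubits. -/
noncomputable abbrev copyPlayer {I : Type*} (T : ℕ) (U : ℕ → I → unitaryGroup (QubitBasis k) ℂ) :
    QPlayer I k where
  mem := k
  op t i := if t < T then oneTensor _ (U t i) else permUnitary (copyPerm k)

/-- The protocol in which the players act on the message register alone before time `T`, and then
both copy the message register into their private qubits. -/
noncomputable abbrev copyProtocol (T : ℕ) (U : ℕ → X → unitaryGroup (QubitBasis k) ℂ)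
    (V : ℕ → Y → unitaryGroup (QubitBasis k) ℂ) (out : QubitBasis k → Z) : QProtocol X Y Z where
  width := k
  rounds := T + 1
  al := copyPlayer T U
  bob := copyPlayer T V
  -- With `T + 1` messages the last two actions, at times `T` and `T + 1`, are the copies, one by
  -- each player.
  alOut _ := out
  bobOut _ := out

/-! ### Runs of the copying protocol, prescribed and with one honest deviating player. -/

namespace copyProtocol

open JointState

variable {T : ℕ} {U : ℕ → X → unitaryGroup (QubitBasis k) ℂ}
  {V : ℕ → Y → unitaryGroup (QubitBasis k) ℂ} {out : QubitBasis k → Z}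

theorem applyAl_op {b t : ℕ} (ht : t < T) (x : X) (φ : QubitBasis k → ℂ) (ψ : QubitBasis k → ℂ)
    (β : QubitBasis b → ℂ) :
    applyAl ((copyPlayer T U).op t x).1 (joinAl (tensorVec φ ψ) β) =
      joinAl (tensorVec φ ((U t x).1 *ᵥ ψ)) β := by
  simp only [if_pos ht, oneTensor, applyAl_joinAl, one_kronecker_mulVec_tensorVec]

theorem applyBob_op {a t : ℕ} (ht : t < T) (y : Y) (φ : QubitBasis a → ℂ) (ψ : QubitBasis k → ℂ)
    (β : QubitBasis k → ℂ) :
    applyBob ((copyPlayer T V).op t y).1 (joinAl (tensorVec φ ψ) β) =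
      joinAl (tensorVec φ ((V t y).1 *ᵥ ψ)) β := by
  simp only [if_pos ht, oneTensor, joinAl_tensorVec, applyBob_joinBob,
    one_kronecker_mulVec_tensorVec]

theorem jointRun_eq (x : X) (y : Y) {t : ℕ} (ht : t ≤ T) :
    jointRun (copyPlayer T U) (copyPlayer T V) x y t =
      joinAl (tensorVec (blankVec k) (msgRun U V x y t)) (blankVec k) := by
  induction t with
  | zero => exact blank_eq_joinAl
  | succ t ih =>
    rw [jointRun, msgRun, ih (by omega)]
    split_ifs
    · exact applyAl_op (by omega) ..
    · exact applyBob_op (by omega) ..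

theorem msgDensity_jointRun (x : X) (y : Y) {t : ℕ} (ht : t ≤ T) :
    (jointRun (copyPlayer T U) (copyPlayer T V) x y t).msgDensity =
      vecMulVec (msgRun U V x y t) (star (msgRun U V x y t)) := by
  rw [jointRun_eq x y ht]
  rw [msgDensity_joinAl _ (star_blankVec_dotProduct k), reducedDensity_tensorVec, star_blankVec_dotProduct, one_smul]

/-- The point is that one `φ` serves for both `y` and `y'`. Al's actions keep this by honesty and
the nonzero overlap, Bob's because they touch the message register only. The bound `t ≤ T` matters:
from the copying stage on, the message may be entangled. -/
theorem exists_jointRun_al {A : QPlayer X k} (hA : (copyProtocol T U V out).HonestAl A)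
    {x : X} {y y' : Y} (hne : ∀ t, star (msgRun U V x y t) ⬝ᵥ msgRun U V x y' t ≠ 0)
    {t : ℕ} (ht : t ≤ T) : ∃ φ : QubitBasis A.mem → ℂ, star φ ⬝ᵥ φ = 1 ∧
      jointRun A (copyPlayer T V) x y t =
        joinAl (tensorVec φ (msgRun U V x y t)) (blankVec k) ∧
      jointRun A (copyPlayer T V) x y' t =
        joinAl (tensorVec φ (msgRun U V x y' t)) (blankVec k) := by
  induction t with
  | zero => exact ⟨_, star_blankVec_dotProduct _, blank_eq_joinAl, blank_eq_joinAl⟩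
  | succ t ih =>
    obtain ⟨φ, hφ, h, h'⟩ := ih (by omega)
    by_cases he : Even t
    · have hd : ∀ y, jointRun A (copyPlayer T V) x y t =
          joinAl (tensorVec φ (msgRun U V x y t)) (blankVec k) →
          reducedDensity ((A.op t x).1 *ᵥ tensorVec φ (msgRun U V x y t)) =
          vecMulVec ((U t x).1 *ᵥ msgRun U V x y t) (star ((U t x).1 *ᵥ msgRun U V x y t)) := by
        intro y h
        have := hA x y t (Nat.lt_succ_of_lt ht) he
        rw [msgDensity_jointRun x y ht, jointRun_succ_of_even _ _ _ _ he, msgRun, if_pos he, h,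
          applyAl_joinAl, msgDensity_joinAl _ (star_blankVec_dotProduct k)] at this
        exact this
      obtain ⟨φ', h₀, h₁, h₂⟩ := exists_common_tensorVec (A.op t x) (U t x) hφ
        (star_msgRun_dotProduct U V x y t) (star_msgRun_dotProduct U V x y' t) (hne t)
        (hd y h) (hd y' h')
      refine ⟨φ', h₀, ?_, ?_⟩
      · rw [jointRun_succ_of_even _ _ _ _ he, msgRun, if_pos he, h, ← h₁]
        exact applyAl_joinAl ..
      · rw [jointRun_succ_of_even _ _ _ _ he, msgRun, if_pos he, h', ← h₂]
        exact applyAl_joinAl ..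
    · refine ⟨φ, hφ, ?_, ?_⟩
      · rw [jointRun_succ_of_not_even _ _ _ _ he, msgRun, if_neg he, h]
        exact applyBob_op ht ..
      · rw [jointRun_succ_of_not_even _ _ _ _ he, msgRun, if_neg he, h']
        exact applyBob_op ht ..

theorem exists_jointRun_bob {B : QPlayer Y k} (hB : (copyProtocol T U V out).HonestBob B)
    {x x' : X} {y : Y} (hne : ∀ t, star (msgRun U V x y t) ⬝ᵥ msgRun U V x' y t ≠ 0)
    {t : ℕ} (ht : t ≤ T) : ∃ φ : QubitBasis B.mem → ℂ, star φ ⬝ᵥ φ = 1 ∧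
      jointRun (copyPlayer T U) B x y t =
        joinBob (blankVec k) (tensorVec φ (msgRun U V x y t)) ∧
      jointRun (copyPlayer T U) B x' y t =
        joinBob (blankVec k) (tensorVec φ (msgRun U V x' y t)) := by
  induction t with
  | zero =>
    exact ⟨_, star_blankVec_dotProduct _, blank_eq_joinAl.trans (joinAl_tensorVec ..),
      blank_eq_joinAl.trans (joinAl_tensorVec ..)⟩
  | succ t ih =>
    obtain ⟨φ, hφ, h, h'⟩ := ih (by omega)
    by_cases he : Even t
    · refine ⟨φ, hφ, ?_, ?_⟩
      · rw [jointRun_succ_of_even _ _ _ _ he, msgRun, if_pos he, h, ← joinAl_tensorVec, ← joinAl_tensorVec]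
        exact applyAl_op ht ..
      · rw [jointRun_succ_of_even _ _ _ _ he, msgRun, if_pos he, h', ← joinAl_tensorVec, ← joinAl_tensorVec]
        exact applyAl_op ht ..
    · have hd : ∀ x, jointRun (copyPlayer T U) B x y t =
          joinBob (blankVec k) (tensorVec φ (msgRun U V x y t)) →
          reducedDensity ((B.op t y).1 *ᵥ tensorVec φ (msgRun U V x y t)) =
          vecMulVec ((V t y).1 *ᵥ msgRun U V x y t) (star ((V t y).1 *ᵥ msgRun U V x y t)) := by
        intro x h
        have := hB x y t (Nat.lt_succ_of_lt ht) (Nat.not_even_iff_odd.1 he)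
        rw [msgDensity_jointRun x y ht, jointRun_succ_of_not_even _ _ _ _ he, msgRun, if_neg he, h,
          applyBob_joinBob, msgDensity_joinBob _ (star_blankVec_dotProduct k)] at this
        exact this
      obtain ⟨φ', h₀, h₁, h₂⟩ := exists_common_tensorVec (B.op t y) (V t y) hφ
        (star_msgRun_dotProduct U V x y t) (star_msgRun_dotProduct U V x' y t) (hne t)
        (hd x h) (hd x' h')
      refine ⟨φ', h₀, ?_, ?_⟩
      · rw [jointRun_succ_of_not_even _ _ _ _ he, msgRun, if_neg he, h, ← h₁]
        exact applyBob_joinBob ..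
      · rw [jointRun_succ_of_not_even _ _ _ _ he, msgRun, if_neg he, h', ← h₂]
        exact applyBob_joinBob ..

/-- The final state of an honest player in Al's place depends on Bob's input only through the final
message. -/
theorem finalAl_eq {A : QPlayer X k} (hA : (copyProtocol T U V out).HonestAl A)
    {x : X} {y y' : Y} (hne : ∀ t, star (msgRun U V x y t) ⬝ᵥ msgRun U V x y' t ≠ 0)
    (hT : msgRun U V x y T = msgRun U V x y' T) :
    (copyProtocol T U V out).finalAl A x y = (copyProtocol T U V out).finalAl A x y' := by
  obtain ⟨φ, -, h, h'⟩ := exists_jointRun_al hA hne le_rfl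
  rw [← hT, ← h] at h'
  -- The joint states already agree at time `T`. Al's later actions depend on `x` only, and Bob's
  -- copying ignores his input, so honesty in the last messages plays no role.
  have : jointRun A (copyPlayer T V) x y (T + 1 + 1) =
      jointRun A (copyPlayer T V) x y' (T + 1 + 1) := by
    simp only [jointRun, h', lt_irrefl, if_false, if_neg (not_lt.2 (Nat.le_succ T))]
  exact congrArg alDensity this

/-- The final state of an honest player in Bob's place depends on Al's input only through the final
message. -/
theorem finalBob_eq {B : QPlayer Y k} (hB : (copyProtocol T U V out).HonestBob B)
    {x x' : X} {y : Y} (hne : ∀ t, star (msgRun U V x y t) ⬝ᵥ msgRun U V x' y t ≠ 0)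
    (hT : msgRun U V x y T = msgRun U V x' y T) :
    (copyProtocol T U V out).finalBob B x y = (copyProtocol T U V out).finalBob B x' y := by
  obtain ⟨φ, -, h, h'⟩ := exists_jointRun_bob hB hne le_rfl
  rw [← hT, ← h] at h'
  have : jointRun (copyPlayer T U) B x y (T + 1 + 1) =
      jointRun (copyPlayer T U) B x' y (T + 1 + 1) := by
    simp only [jointRun, h', lt_irrefl, if_false, if_neg (not_lt.2 (Nat.le_succ T))]
  exact congrArg bobDensity this

/-- Traced backwards, each copy clears a private register that agrees with the message. Evenness of
`T` makes Al copy at time `T` and Bob at `T + 1`. -/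
theorem jointRun_final (hT : Even T) (x : X) (y : Y) (s : QubitBasis k) :
    jointRun (copyPlayer T U) (copyPlayer T V) x y (T + 1 + 1) (s, s, s) =
      msgRun U V x y T s := by
  have hT' : ¬ Even (T + 1) := by simpa [Nat.even_add_one] using hT
  rw [jointRun_succ_of_not_even _ _ _ _ hT', jointRun_succ_of_even _ _ _ _ hT,
    jointRun_eq x y le_rfl]
  simp only [lt_irrefl, if_false, if_neg (not_lt.2 (Nat.le_succ T))]
  rw [applyBob_eq_mulVec, permUnitary_mulVec, Function.comp, copyPerm_inv, copyPerm_self,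
    applyAl_eq_mulVec, permUnitary_mulVec, Function.comp, copyPerm_inv, copyPerm_self]
  simp [joinAl, tensorVec, blankVec]

/-- The bound keeps a single outcome, in which both private registers and the message all read `s`.
-/
theorem le_successProb (hT : Even T) (f : X → Y → Z) (x : X) (y : Y) {s : QubitBasis k}
    (hs : out s = f x y) :
    ‖msgRun U V x y T s‖ ^ 2 ≤ (copyProtocol T U V out).successProb f x y := by
  have := Finset.single_le_sum (s := Finset.univ)
    (f := fun s : QubitBasis k × QubitBasis k × QubitBasis k =>
      open Classical in if out s.1 = f x y ∧ out s.2.2 = f x y then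
      ‖jointRun (copyPlayer T U) (copyPlayer T V) x y (T + 1 + 1) s‖ ^ 2
      else 0) (fun _ _ => by split_ifs <;> positivity) (Finset.mem_univ (s, s, s))
  simp only [hs, and_self, if_true, jointRun_final hT] at this
  exact this

end copyProtocol

end MessageProtocol

/-! ### Quantum protocols from reversible computations -/

section Reversible

open Matrix

variable {X : Type u} {Y : Type v} {Z : Type w}

/-- The state after `t` steps of a computation in which Al and Bob alternately permute the states,
starting from `s₀`. -/
def permRun {S : Type*} (σ : ℕ → X → Equiv.Perm S) (τ : ℕ → Y → Equiv.Perm S) (s₀ : S)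
    (x : X) (y : Y) : ℕ → S
  | 0 => s₀
  | t + 1 => if Even t then σ t x (permRun σ τ s₀ x y t) else τ t y (permRun σ τ s₀ x y t)

theorem permRun_ne {S : Type*} {σ : ℕ → X → Equiv.Perm S} {τ : ℕ → Y → Equiv.Perm S} {s₀ d : S}
    (hd : s₀ ≠ d) (hσ : ∀ t x, σ t x d = d) (hτ : ∀ t y, τ t y d = d) (x : X) (y : Y) (t : ℕ) :
    permRun σ τ s₀ x y t ≠ d := by
  induction t with
  | zero => exact hd
  | succ t ih =>
    rw [permRun]
    split_ifs
    · exact fun h => ih ((σ t x).injective (h.trans (hσ t x).symm))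
    · exact fun h => ih ((τ t y).injective (h.trans (hτ t y).symm))

/-- The overlap is `q²` or `p² + q²`, according to whether `i` and `j` differ or coincide; the dummy
component alone makes it positive. -/
theorem star_single_add_single_dotProduct_ne_zero {α : Type*} [Fintype α] [DecidableEq α]
    {i j d : α} (hi : i ≠ d) (hj : j ≠ d) (p : ℝ) {q : ℝ} (hq : q ≠ 0) :
    star (Pi.single i (p : ℂ) + Pi.single d (q : ℂ) : α → ℂ) ⬝ᵥ
      (Pi.single j (p : ℂ) + Pi.single d (q : ℂ)) ≠ 0 := by
  rw [star_add, ← Pi.single_star, ← Pi.single_star]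
  simp only [RCLike.star_def, Complex.conj_ofReal, add_dotProduct, single_dotProduct, Pi.add_apply,
    Pi.single_eq_same, Pi.single_eq_of_ne hi, Pi.single_eq_of_ne hj.symm, Pi.single_apply]
  split_ifs
  · norm_cast
    have := mul_self_pos.2 hq
    nlinarith [mul_self_nonneg p]
  · norm_cast
    simpa using hq

variable {k : ℕ}

/-- A reversible computation on the message register that fixes some dummy state, and whose final
state is determined by the function value and determines it, gives a quantum protocol that does not
reveal more than the function value. -/
theorem exists_private_protocol (f : X → Y → Z) {T : ℕ} (hT : Even T) (hT₀ : 0 < T)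
    {σ : ℕ → X → Equiv.Perm (QubitBasis k)} {τ : ℕ → Y → Equiv.Perm (QubitBasis k)}
    {d : QubitBasis k} (hd : (fun _ => false) ≠ d) (hσ : ∀ t x, σ t x d = d)
    (hτ : ∀ t y, τ t y d = d) {code : Z → QubitBasis k} {out : QubitBasis k → Z}
    (hrun : ∀ x y, permRun σ τ (fun _ => false) x y T = code (f x y))
    (hout : ∀ x y, out (code (f x y)) = f x y) {ε : ℝ} (hε : 0 < ε) :
    ∃ P : QProtocol X Y Z,
      P.cost = (T + 1) * k ∧
      P.ComputesWithError f ε ∧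
      (∀ A : QPlayer X P.width, P.HonestAl A →
        ∀ x y y', f x y = f x y' → P.finalAl A x y = P.finalAl A x y') ∧
      (∀ B : QPlayer Y P.width, P.HonestBob B →
        ∀ x x' y, f x y = f x' y → P.finalBob B x y = P.finalBob B x' y) := by
  -- With `p = 1 - 2 r` the success probability is at least `p² ≥ 1 - 4 r ≥ 1 - ε`; the minimum with
  -- 1 keeps `r` below 1.
  set r : ℝ := min ε 1 / 4 with hr
  have hr0 : 0 < r := by positivity
  have hr1 : r ≤ 1 / 4 := by rw [hr]; linarith [min_le_right ε 1]
  have hr2 : 4 * r ≤ ε := by rw [hr]; linarith [min_le_left ε 1]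
  obtain ⟨H, q, hq, hH⟩ := exists_unitary_superposition hd hr0 (by linarith)
  set p : ℝ := 1 - 2 * r
  -- Al's first action prepares the superposition with the dummy state before making the first move.
  let U : ℕ → X → unitaryGroup (QubitBasis k) ℂ := fun t x =>
    if t = 0 then permUnitary (σ 0 x) * H else permUnitary (σ t x)
  let V : ℕ → Y → unitaryGroup (QubitBasis k) ℂ := fun t y => permUnitary (τ t y)
  have hmsg : ∀ x y t, msgRun U V x y (t + 1) =
      Pi.single (permRun σ τ (fun _ => false) x y (t + 1)) (p : ℂ) + Pi.single d (q : ℂ) := by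
    intro x y t
    induction t with
    | zero =>
      rw [msgRun, permRun, if_pos Even.zero, if_pos Even.zero, permRun, msgRun]
      simp only [U, if_true]
      change (((permUnitary (σ 0 x)).1 * H.1) *ᵥ Pi.single _ 1) = _
      rw [← mulVec_mulVec, hH, mulVec_add, permUnitary_mulVec_single, permUnitary_mulVec_single, hσ]
    | succ t ih =>
      rw [msgRun, permRun, ih]
      split_ifs
      · simp only [U, if_neg (Nat.succ_ne_zero t)]
        rw [mulVec_add, permUnitary_mulVec_single, permUnitary_mulVec_single, hσ]
      · rw [mulVec_add, permUnitary_mulVec_single, permUnitary_mulVec_single, hτ]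
  have hne : ∀ x y x' y' t, star (msgRun U V x y t) ⬝ᵥ msgRun U V x' y' t ≠ 0 := by
    intro x y x' y' t
    cases t with
    | zero => exact (JointState.star_blankVec_dotProduct k).trans_ne one_ne_zero
    | succ t =>
      rw [hmsg, hmsg]
      exact star_single_add_single_dotProduct_ne_zero (permRun_ne hd hσ hτ _ _ _)
        (permRun_ne hd hσ hτ _ _ _) p hq
  have hmsgT : ∀ x y, msgRun U V x y T =
      Pi.single (code (f x y)) (p : ℂ) + Pi.single d (q : ℂ) := by
    intro x y
    obtain ⟨t, rfl⟩ := Nat.exists_eq_succ_of_ne_zero hT₀.ne'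
    rw [hmsg, hrun]
  refine ⟨copyProtocol T U V out, rfl, fun x y => ?_, fun A hA x y y' h => ?_,
    fun B hB x x' y h => ?_⟩
  · refine le_trans ?_ (copyProtocol.le_successProb hT f x y (hout x y))
    have hcd : code (f x y) ≠ d := hrun x y ▸ permRun_ne hd hσ hτ x y T
    rw [hmsgT, Pi.add_apply, Pi.single_eq_same, Pi.single_eq_of_ne hcd, add_zero,
      Complex.norm_real, Real.norm_eq_abs, sq_abs]
    nlinarith [mul_self_nonneg r]
  · exact copyProtocol.finalAl_eq hA (hne x y x y') (by rw [hmsgT, hmsgT, h])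
  · exact copyProtocol.finalBob_eq hB (hne x y x' y) (by rw [hmsgT, hmsgT, h])

end Reversible

/-! ### Encoding an arbitrary finite state set, with a dummy element, into qubits. -/

section Reversible

variable {X : Type u} {Y : Type v} {Z : Type w}

theorem permRun_viaEmbedding {S M : Type*} (ι : Option S ↪ M) (σ : ℕ → X → Equiv.Perm S)
    (τ : ℕ → Y → Equiv.Perm S) (s₀ : S) (x : X) (y : Y) (t : ℕ) :
    permRun (fun t x => Equiv.Perm.viaEmbedding (Equiv.optionCongr (σ t x)) ι)
      (fun t y => Equiv.Perm.viaEmbedding (Equiv.optionCongr (τ t y)) ι) (ι (some s₀)) x y t =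
      ι (some (permRun σ τ s₀ x y t)) := by
  induction t with
  | zero => rfl
  | succ t ih =>
    rw [permRun, permRun, ih]
    split_ifs <;> rw [Equiv.Perm.viaEmbedding_apply] <;> rfl

/-- A reversible computation on an arbitrary finite set that can be encoded into `k` qubits gives a
quantum protocol that does not reveal more than the function value. -/
theorem exists_private_protocol_of_card (f : X → Y → Z) {T k : ℕ} (hT : Even T) (hT₀ : 0 < T)
    {S : Type*} [Fintype S] (hS : Fintype.card S + 1 ≤ 2 ^ k)
    {σ : ℕ → X → Equiv.Perm S} {τ : ℕ → Y → Equiv.Perm S} {s₀ : S} {code : Z → S} {out : S → Z}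
    (hrun : ∀ x y, permRun σ τ s₀ x y T = code (f x y))
    (hout : ∀ x y, out (code (f x y)) = f x y) {ε : ℝ} (hε : 0 < ε) :
    ∃ P : QProtocol X Y Z,
      P.cost = (T + 1) * k ∧
      P.ComputesWithError f ε ∧
      (∀ A : QPlayer X P.width, P.HonestAl A →
        ∀ x y y', f x y = f x y' → P.finalAl A x y = P.finalAl A x y') ∧
      (∀ B : QPlayer Y P.width, P.HonestBob B →
        ∀ x x' y, f x y = f x' y → P.finalBob B x y = P.finalBob B x' y) := by
  classical
  obtain ⟨ι₀⟩ : Nonempty (Option S ↪ QubitBasis k) := by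
    apply Function.Embedding.nonempty_of_card_le
    simpa using hS
  -- The swap makes the code of `s₀` the blank register; `none` becomes the dummy state.
  let ι : Option S ↪ QubitBasis k :=
    ι₀.trans (Equiv.swap (ι₀ (some s₀)) (fun _ => false)).toEmbedding
  have hι : ι (some s₀) = fun _ => false := Equiv.swap_apply_left _ _
  refine exists_private_protocol f hT hT₀ (d := ι none) (code := fun z => ι (some (code z)))
    (σ := fun t x => Equiv.Perm.viaEmbedding (Equiv.optionCongr (σ t x)) ι)
    (τ := fun t y => Equiv.Perm.viaEmbedding (Equiv.optionCongr (τ t y)) ι)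
    (out := fun m => out ((Function.invFun ι m).getD s₀)) ?_ ?_ ?_ ?_ ?_ hε
  · rw [← hι]
    exact fun h => by simpa using ι.injective h
  · exact fun t x => Equiv.Perm.viaEmbedding_apply ..
  · exact fun t y => Equiv.Perm.viaEmbedding_apply ..
  · intro x y
    rw [← hι, permRun_viaEmbedding, hrun]
  · intro x y
    simp only [Function.leftInverse_invFun ι.injective _, Option.getD_some, hout]

end Reversible

/-! ### Reversible simulation of a deterministic protocol -/

namespace DetTree

variable {X : Type u} {Y : Type v} {Z : Type w}

/-- The subtree reached when the given bit is announced. -/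
def next : DetTree X Y Z → Bool → DetTree X Y Z
  | leaf z, _ => leaf z
  | al _ child, b => child b
  | bob _ child, b => child b

/-- The bit that Al announces, if it is his turn. -/
def alBit : DetTree X Y Z → X → Bool
  | leaf _, _ => false
  | al bit _, x => bit x
  | bob _ _, _ => false

/-- The bit that Bob announces, if it is his turn. -/
def bobBit : DetTree X Y Z → Y → Bool
  | leaf _, _ => false
  | al _ _, _ => false
  | bob bit _, y => bit y

/-- The answer at a leaf, and the answer at the leftmost leaf in general. -/
def value : DetTree X Y Z → Z
  | leaf z => z
  | al _ child => (child false).value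
  | bob _ child => (child false).value

/-- The subtree reached after the first `i` bits of the transcript `w`. -/
def walk (t : DetTree X Y Z) (w : ℕ → Bool) : ℕ → DetTree X Y Z
  | 0 => t
  | i + 1 => (t.walk w i).next (w i)

/-- The subtree reached after `i` bits on inputs `x`, `y`. -/
def node (t : DetTree X Y Z) (x : X) (y : Y) : ℕ → DetTree X Y Z
  | 0 => t
  | i + 1 => (t.node x y i).next (xor ((t.node x y i).alBit x) ((t.node x y i).bobBit y))

/-- The transcript on inputs `x`, `y`. -/
def transcript (t : DetTree X Y Z) (x : X) (y : Y) (i : ℕ) : Bool :=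
  xor ((t.node x y i).alBit x) ((t.node x y i).bobBit y)

theorem walk_congr (t : DetTree X Y Z) {w w' : ℕ → Bool} {i : ℕ} (h : ∀ j < i, w j = w' j) :
    t.walk w i = t.walk w' i := by
  induction i with
  | zero => rfl
  | succ i ih => rw [walk, walk, ih fun j hj => h j (by omega), h i (by omega)]

theorem walk_transcript (t : DetTree X Y Z) (x : X) (y : Y) (i : ℕ) :
    t.walk (t.transcript x y) i = t.node x y i := by
  induction i with
  | zero => rfl
  | succ i ih => rw [walk, ih, node, transcript]

/-- A player who is not to speak contributes `false`, so the `xor` of the two bits is the announced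
bit, and both players can act at every node. -/
theorem eval_node (t : DetTree X Y Z) (x : X) (y : Y) (i : ℕ) :
    (t.node x y i).eval x y = t.eval x y := by
  induction i with
  | zero => rfl
  | succ i ih =>
    rw [← ih, node]
    cases t.node x y i <;> simp [next, alBit, bobBit, eval]

/-- A leaf is its own successor; truncated subtraction covers this case. -/
theorem depth_next (t : DetTree X Y Z) (b : Bool) : (t.next b).depth ≤ t.depth - 1 := by
  cases t <;> cases b <;> simp [next, depth]

theorem depth_node (t : DetTree X Y Z) (x : X) (y : Y) (i : ℕ) :
    (t.node x y i).depth ≤ t.depth - i := by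
  induction i with
  | zero => exact le_rfl
  | succ i ih =>
    rw [node]
    exact (depth_next ..).trans (by omega)

theorem eval_eq_value {t : DetTree X Y Z} (h : t.depth = 0) (x : X) (y : Y) :
    t.eval x y = t.value := by
  cases t <;> simp_all [depth, eval, value]

theorem value_node (t : DetTree X Y Z) (x : X) (y : Y) {c : ℕ} (hc : t.depth ≤ c) :
    (t.node x y c).value = t.eval x y := by
  rw [← t.eval_node x y c, eval_eq_value]
  have := t.depth_node x y c
  omega

/-! ### Computing the transcript, recording the answer, uncomputing. -/

section Simulation

variable {c : ℕ}

/-- A register of `c` bits as a transcript, padded with `false`. -/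
def pad (w : Fin c → Bool) (i : ℕ) : Bool := if h : i < c then w ⟨i, h⟩ else false

/-- The first `j` bits of the transcript, in a register of `c` bits. -/
def partialTranscript (t : DetTree X Y Z) (c : ℕ) (x : X) (y : Y) (j : ℕ) : Fin c → Bool :=
  fun i => if i.1 < j then t.transcript x y i else false

theorem partialTranscript_zero (t : DetTree X Y Z) (x : X) (y : Y) :
    t.partialTranscript c x y 0 = fun _ => false :=
  funext fun i => if_neg (Nat.not_lt_zero i)

theorem pad_update (w : Fin c → Bool) (i : Fin c) (b : Bool) {j : ℕ} (hj : j < i) :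
    pad (Function.update w i b) j = pad w j := by
  have hjc : j < c := hj.trans i.2
  have : (⟨j, hjc⟩ : Fin c) ≠ i := fun h => hj.ne (congrArg Fin.val h)
  simp [pad, hjc, Function.update_of_ne this]

/-- Changing bit `i` does not affect the node at depth `i`; this is what makes `flip` an involution.
-/
theorem walk_pad_update (t : DetTree X Y Z) (w : Fin c → Bool) (i : Fin c) (b : Bool) :
    t.walk (pad (Function.update w i b)) i = t.walk (pad w) i :=
  t.walk_congr fun _ hj => pad_update w i b hj

/-- Addition to the bit number `i` of a bit which depends on the node described by the bits before
it. -/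
def flip (t : DetTree X Y Z) (i : Fin c) (g : DetTree X Y Z → Bool) :
    Equiv.Perm (Fin c → Bool) :=
  Function.Involutive.toPerm
    (fun w => Function.update w i (xor (w i) (g (t.walk (pad w) i))))
    (fun w => by simp [walk_pad_update])

theorem flip_apply (t : DetTree X Y Z) (i : Fin c) (g : DetTree X Y Z → Bool) (w : Fin c → Bool) :
    t.flip i g w = Function.update w i (xor (w i) (g (t.walk (pad w) i))) := rfl

theorem flip_flip (t : DetTree X Y Z) (x : X) (y : Y) (i : Fin c) {w : Fin c → Bool}
    (hw : ∀ j < i, w j = t.transcript x y j) :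
    t.flip i (fun n => n.bobBit y) (t.flip i (fun n => n.alBit x) w) =
      Function.update w i (xor (w i) (t.transcript x y i)) := by
  have h : t.walk (pad w) i = t.node x y i := by
    rw [← walk_transcript]
    refine t.walk_congr fun j hj => ?_
    have hjc : j < c := hj.trans i.2
    rw [pad, dif_pos hjc]
    exact hw ⟨j, hjc⟩ hj
  rw [flip_apply, flip_apply, walk_pad_update, h, Function.update_self, Function.update_idem,
    Bool.xor_assoc, transcript]

theorem flip_flip_partialTranscript (t : DetTree X Y Z) (x : X) (y : Y) (i : Fin c) :
    t.flip i (fun n => n.bobBit y) (t.flip i (fun n => n.alBit x) (t.partialTranscript c x y i)) =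
      t.partialTranscript c x y (i + 1) := by
  rw [flip_flip t x y i fun j hj => by simp [partialTranscript, hj]]
  ext j
  by_cases hj : j = i
  · subst hj; simp [partialTranscript]
  · have : (j : ℕ) ≠ i := fun h => hj (Fin.ext h)
    rw [Function.update_of_ne hj, partialTranscript, partialTranscript]
    congr 1
    simp only [eq_iff_iff]
    omega

/-- The pair of moves that writes bit `i` also erases it, because the earlier bits that determine
the node are still present. -/
theorem flip_flip_partialTranscript_succ (t : DetTree X Y Z) (x : X) (y : Y) (i : Fin c) :
    t.flip i (fun n => n.bobBit y)
      (t.flip i (fun n => n.alBit x) (t.partialTranscript c x y (i + 1))) =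
      t.partialTranscript c x y i := by
  rw [flip_flip t x y i fun j hj => by
    have : (j : ℕ) < i + 1 := Nat.lt_succ_of_lt hj
    simp [partialTranscript, this]]
  ext j
  by_cases hj : j = i
  · subst hj; simp [partialTranscript]
  · have : (j : ℕ) ≠ i := fun h => hj (Fin.ext h)
    rw [Function.update_of_ne hj, partialTranscript, partialTranscript]
    congr 1
    simp only [eq_iff_iff]
    omega

/-- The answer described by a full transcript. -/
def answer (t : DetTree X Y Z) (w : Fin c → Bool) : Z := (t.walk (pad w) c).value

theorem answer_partialTranscript (t : DetTree X Y Z) (x : X) (y : Y) (hc : t.depth ≤ c) :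
    t.answer (t.partialTranscript c x y c) = t.eval x y := by
  rw [answer, ← t.value_node x y hc, ← walk_transcript]
  refine congrArg value (t.walk_congr fun j hj => ?_)
  simp [pad, partialTranscript, hj]

open Classical in
/-- A transcript chosen for each answer. -/
noncomputable def canonical (t : DetTree X Y Z) (c : ℕ) (z : Z) : Fin c → Bool :=
  -- Different transcripts may give the same answer; choosing one per answer hides which of them
  -- occurred and fits the answer into `c` bits whatever the size of `Z`.
  if h : ∃ w : Fin c → Bool, t.answer w = z then h.choose else fun _ => false

theorem answer_canonical (t : DetTree X Y Z) (x : X) (y : Y) (hc : t.depth ≤ c) :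
    t.answer (t.canonical c (t.eval x y)) = t.eval x y := by
  have h : ∃ w : Fin c → Bool, t.answer w = t.eval x y := ⟨_, t.answer_partialTranscript x y hc⟩
  rw [canonical, dif_pos h]
  exact h.choose_spec

/-- The states of the reversible simulation: a transcript and a register for the answer. -/
abbrev SimState (c : ℕ) : Type := (Fin c → Bool) × Option (Fin c → Bool)

/-- Writing the answer described by the transcript into the answer register. -/
noncomputable def writeAnswer (t : DetTree X Y Z) (c : ℕ) : Equiv.Perm (SimState c) :=
  Equiv.prodShear (Equiv.refl _) fun w => Equiv.swap none (some (t.canonical c (t.answer w)))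

/-- Al's moves in the reversible simulation. Moves number `2 j` and `2 j + 1` deal with bit number
`j` of the transcript if `j < c`, with the answer if `j = c`, and with the removal of bit number
`2 c - j` if `j > c`. -/
noncomputable def alMove (t : DetTree X Y Z) (c : ℕ) (n : ℕ) (x : X) : Equiv.Perm (SimState c) :=
  if n / 2 = c then t.writeAnswer c
  else if h : min (n / 2) (2 * c - n / 2) < c then
    (t.flip ⟨min (n / 2) (2 * c - n / 2), h⟩ fun n => n.alBit x).prodCongr (Equiv.refl _)
  -- This branch is reached only for `c = 0`.
  else 1

/-- Bob's moves in the reversible simulation. -/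
def bobMove (t : DetTree X Y Z) (c : ℕ) (n : ℕ) (y : Y) : Equiv.Perm (SimState c) :=
  if n / 2 = c then 1
  else if h : min (n / 2) (2 * c - n / 2) < c then
    (t.flip ⟨min (n / 2) (2 * c - n / 2), h⟩ fun n => n.bobBit y).prodCongr (Equiv.refl _)
  else 1

theorem permRun_pair {S : Type*} (σ : ℕ → X → Equiv.Perm S) (τ : ℕ → Y → Equiv.Perm S) (s₀ : S)
    (x : X) (y : Y) (j : ℕ) : permRun σ τ s₀ x y (2 * (j + 1)) =
      τ (2 * j + 1) y (σ (2 * j) x (permRun σ τ s₀ x y (2 * j))) := by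
  rw [show 2 * (j + 1) = 2 * j + 1 + 1 by ring, permRun, permRun, if_pos (even_two_mul j),
    if_neg (by simp)]

theorem bobMove_alMove (t : DetTree X Y Z) {j : ℕ} (i : Fin c) (hj : j ≠ c)
    (hi : min j (2 * c - j) = i) (x : X) (y : Y) (w : Fin c → Bool)
    (o : Option (Fin c → Bool)) :
    t.bobMove c (2 * j + 1) y (t.alMove c (2 * j) x (w, o)) =
      (t.flip i (fun n => n.bobBit y) (t.flip i (fun n => n.alBit x) w), o) := by
  have h₁ : 2 * j / 2 = j := by omega
  have h₂ : (2 * j + 1) / 2 = j := by omega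
  simp only [bobMove, alMove, h₁, h₂, if_neg hj, hi, i.2, dif_pos, Fin.eta]
  rfl

theorem permRun_forward (t : DetTree X Y Z) (x : X) (y : Y) {j : ℕ} (hj : j ≤ c) :
    permRun (t.alMove c) (t.bobMove c) (fun _ => false, none) x y (2 * j) =
      (t.partialTranscript c x y j, none) := by
  induction j with
  | zero => rw [partialTranscript_zero]; rfl
  | succ j ih =>
    rw [permRun_pair, ih (by omega), bobMove_alMove t ⟨j, hj⟩ (by omega) (by simp; omega),
      ← flip_flip_partialTranscript t x y ⟨j, hj⟩]

theorem permRun_backward (t : DetTree X Y Z) (x : X) (y : Y) (hc : t.depth ≤ c) {j : ℕ}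
    (hj : j ≤ c) :
    permRun (t.alMove c) (t.bobMove c) (fun _ => false, none) x y (2 * (c + 1 + j)) =
      (t.partialTranscript c x y (c - j), some (t.canonical c (t.eval x y))) := by
  induction j with
  | zero =>
    have h₁ : 2 * c / 2 = c := by omega
    have h₂ : (2 * c + 1) / 2 = c := by omega
    rw [add_zero, permRun_pair, permRun_forward t x y le_rfl]
    simp only [bobMove, alMove, h₁, h₂, if_true, writeAnswer]
    simp [Equiv.prodShear, answer_partialTranscript t x y hc]
  | succ j ih =>
    -- Pair number `c + 1 + j` of moves treats bit `2 c - (c + 1 + j) = c - (j + 1)`, the last one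
    -- still written.
    obtain ⟨i, hi⟩ : ∃ i : Fin c, (i : ℕ) = c - (j + 1) := ⟨⟨c - (j + 1), by omega⟩, rfl⟩
    rw [show c + 1 + (j + 1) = c + 1 + j + 1 by ring, permRun_pair, ih (by omega),
      bobMove_alMove t i (by omega) (by omega), ← hi, show c - j = i + 1 by omega,
      flip_flip_partialTranscript_succ]

theorem permRun_moves (t : DetTree X Y Z) (x : X) (y : Y) (hc : t.depth ≤ c) :
    permRun (t.alMove c) (t.bobMove c) (fun _ => false, none) x y (2 * (c + 1 + c)) =
      (fun _ => false, some (t.canonical c (t.eval x y))) := by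
  rw [permRun_backward t x y hc le_rfl, Nat.sub_self, partialTranscript_zero]

/-- With `n = 2 ^ c` the claim is `n (n + 1) + 1 ≤ 2 n²`, which holds for `n ≥ 2` but fails for `c =
0`. -/
theorem card_simState (hc : 0 < c) : Fintype.card (SimState c) + 1 ≤ 2 ^ (2 * c + 1) := by
  have h : 2 ≤ 2 ^ c := Nat.le_self_pow hc.ne' 2
  simp only [Fintype.card_prod, Fintype.card_option, Fintype.card_fun, Fintype.card_bool,
    Fintype.card_fin, pow_succ, two_mul, pow_add]
  nlinarith

end Simulation

end DetTree

/-! ### From communication complexity to a tree, and the protocol without communication. -/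

section Main

open Matrix

variable {X : Type u} {Y : Type v} {Z : Type w}

theorem exists_detTree {f : X → Y → Z} {c : ℕ} (h : detCC f = c) :
    ∃ t : DetTree X Y Z, t.depth ≤ c ∧ ∀ x y, t.eval x y = f x y := by
  by_contra! hcon
  have : ((c + 1 : ℕ) : ℕ∞) ≤ detCC f := by
    refine le_iInf₂ fun t ht => ?_
    rw [Nat.cast_le, Nat.succ_le_iff]
    by_contra! hlt
    obtain ⟨x, y, hxy⟩ := hcon t hlt
    exact hxy (ht x y)
  rw [h, Nat.cast_le] at this
  omega

/-- The protocol without communication that always gives the answer `z`. -/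
def constProtocol (X : Type u) (Y : Type v) (z : Z) : QProtocol X Y Z where
  width := 0
  rounds := 0
  al := ⟨0, fun _ _ => 1⟩
  bob := ⟨0, fun _ _ => 1⟩
  alOut _ _ := z
  bobOut _ _ := z

theorem successProb_constProtocol (z : Z) {f : X → Y → Z} {x : X} {y : Y} (h : f x y = z) :
    (constProtocol X Y z).successProb f x y = 1 := by
  -- Every outcome counts as success, so the success probability is the squared norm of the final
  -- state.
  have := star_jointRun_dotProduct (constProtocol X Y z).al (constProtocol X Y z).bob x y 1
  rw [QProtocol.successProb, ← Complex.ofReal_inj, Complex.ofReal_one, ← this]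
  simp only [dotProduct, Complex.ofReal_sum, Pi.star_apply, RCLike.star_def, Complex.conj_mul']
  refine Finset.sum_congr rfl fun s _ => ?_
  rw [if_pos ⟨h.symm, h.symm⟩, Complex.ofReal_pow]
  rfl

end Main

theorem mainTheorem10 :
    ∃ C : ℕ, ∀ (X : Type u) (Y : Type v) (Z : Type w) (f : X → Y → Z) (c : ℕ),
      detCC f = (c : ℕ∞) → ∀ ε : ℝ, 0 < ε →
        ∃ P : QProtocol X Y Z,
          P.cost ≤ C * c ^ 2 ∧
          P.ComputesWithError f ε ∧
          (∀ A : QPlayer X P.width, P.HonestAl A →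
            ∃ σ : X → Z → Matrix (QubitBasis A.mem) (QubitBasis A.mem) ℂ,
              (∀ x z, IsDensityMatrix (σ x z)) ∧
              ∀ x y, traceNorm (P.finalAl A x y - σ x (f x y)) ≤ ε) ∧
          (∀ B : QPlayer Y P.width, P.HonestBob B →
            ∃ σ : Y → Z → Matrix (QubitBasis B.mem) (QubitBasis B.mem) ℂ,
              (∀ y z, IsDensityMatrix (σ y z)) ∧
              ∀ x y, traceNorm (P.finalBob B x y - σ y (f x y)) ≤ ε) := by
  -- There are `4 c + 3` messages of `2 c + 1` qubits, and `(4 c + 3) (2 c + 1) ≤ 7 c * 3 c` for `c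
  -- ≥ 1`.
  refine ⟨21, fun X Y Z f c hf ε hε => ?_⟩
  obtain ⟨t, hc, ht⟩ := exists_detTree hf
  suffices ∃ P : QProtocol X Y Z,
      P.cost ≤ 21 * c ^ 2 ∧
      P.ComputesWithError f ε ∧
      (∀ A : QPlayer X P.width, P.HonestAl A →
        ∀ x y y', f x y = f x y' → P.finalAl A x y = P.finalAl A x y') ∧
      (∀ B : QPlayer Y P.width, P.HonestBob B →
        ∀ x x' y, f x y = f x' y → P.finalBob B x y = P.finalBob B x' y) by
    obtain ⟨P, h₁, h₂, h₃, h₄⟩ := this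
    exact ⟨P, h₁, h₂, fun A hA => P.exists_alDensity_of_finalAl_eq A (h₃ A hA) hε.le,
      fun B hB => P.exists_bobDensity_of_finalBob_eq B (h₄ B hB) hε.le⟩
  -- For `c = 0` no qubit may be sent, but then the tree is a leaf and the answer is constant.
  rcases Nat.eq_zero_or_pos c with rfl | hpos
  · refine ⟨constProtocol X Y t.value, by simp [constProtocol, QProtocol.cost], fun x y => ?_,
      fun A _ x y y' _ => rfl, fun B _ x x' y _ => rfl⟩
    rw [successProb_constProtocol _
      ((ht x y).symm.trans (DetTree.eval_eq_value (Nat.le_zero.1 hc) x y))]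
    linarith
  · obtain ⟨P, h₁, h₂⟩ := exists_private_protocol_of_card f (even_two_mul (c + 1 + c)) (by omega)
      (DetTree.card_simState hpos) (σ := t.alMove c) (τ := t.bobMove c)
      (s₀ := (fun _ => false, none)) (code := fun z => (fun _ => false, some (t.canonical c z)))
      (out := fun s => t.answer (s.2.getD fun _ => false))
      (fun x y => by rw [t.permRun_moves x y hc, ht])
      (fun x y => by rw [Option.getD_some, ← ht, t.answer_canonical x y hc]) hε
    refine ⟨P, ?_, h₂⟩
    rw [h₁]
    nlinarith
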